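/- Consider a bandit with arms $1,\dots,N$, where the rewards of arm $i$ are i.i.d. with law $\nu_i$ on $[0,1]$, mean $\mu_i$ and variance $\sigma_i^2$, and arm $1$ is optimal, i.e. $\mu_1=\max_i\mu_i$. Put $\Delta_i=\mu_1-\mu_i$. A (measurable) probability function $p:[0,1]\to[0,1]$ defines the Bernoulli mechanism: each reward $r$ is replaced by a variable $Y\in\{0,1\}$ with $\Pr(Y=1\mid r)=p(r)$, independently for the different plays. The privatized mean of arm $i$ is $\mu_{i,\epsilon}=E_{r\sim\nu_i}[p(r)]$, and its privatized gap is $\Delta_{i,\epsilon}=\max_j\mu_{j,\epsilon}-\mu_{i,\epsilon}$. UCB is run on the privatized rewards: each arm is first played once; afterwards, when $t$ rounds have been played, $N_i(t)$ of them on arm $i$, with average $\hat\mu_i(t)$ of the privatized rewards observed on arm $i$, the next arm played maximizes $\hat\mu_i(t)+\sqrt{2\log t/N_i(t)}$ (ties broken in any way). The regret is $R(T)=E\big[\sum_{t=1}^T(\mu_1-\mu_{I_t})\big]$, where $I_t$ is the arm played in round $t$. (a) If $\Delta_{i,\epsilon}>0$ for every arm $i$ with $\Delta_i>0$, then for every $T\ge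 1$ $$R(T)\le\sum_{i\ne1}\Big\{\frac{8\log T}{\Delta_{i,\epsilon}^2}+1+\frac{\pi^2}{3}\Big\}\Delta_i ,$$ where the terms with $\Delta_i=0$ are read as $0$. (b) Let $\epsilon>0$, $b\in[0,2(e^\epsilon-1)]$ and $p(r)=\frac{(e^\epsilon-1-b)r^2+br+1}{1+e^\epsilon}$ (quadratic probability function). Then $$\mu_{1,\epsilon}-\mu_{i,\epsilon}=\frac{\{(e^\epsilon-1-b)(\mu_1+\mu_i)+b\}(\mu_1-\mu_i)+(e^\epsilon-1-b)(\sigma_1^2-\sigma_i^2)}{e^\epsilon+1}$$ for every $i$, and if this is positive for every arm $i$ with $\Delta_i>0$, then the bound in (a) holds with this expression in place of $\Delta_{i,\epsilon}$. (c) Let $\epsilon>0$ and $p(r)=\frac{e^{\epsilon r}}{e^\epsilon+1}$ (exponential probability function), and let $\tau_i(\epsilon)=E_{r\sim\nu_i}[e^{\epsilon r}]-e^{\epsilon\mu_i}$. Then $$\mu_{1,\epsilon}-\mu_{i,\epsilon}=\frac{e^{\epsilon\mu_i}(e^{\epsilon\Delta_i}-1)+\tau_1(\epsilon)-\tau_i(\epsilon)}{e^\epsilon+1}$$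 for every $i$, and if this is positive for every arm $i$ with $\Delta_i>0$, then the bound in (a) holds with this expression in place of $\Delta_{i,\epsilon}$. -/

import Mathlib

open MeasureTheory ProbabilityTheory

noncomputable section

namespace PrivateBandit

/-! ### Reward laws on `[0, 1]` -/

/-- The mean reward `μ_i = E[r]` of an arm with reward law `ν`. -/
def mean (ν : Measure unitInterval) : ℝ := ∫ r, (r : ℝ) ∂ν

/-- The reward variance `σ_i²` of an arm with reward law `ν`. -/
def rewardVar (ν : Measure unitInterval) : ℝ := variance (fun r : unitInterval => (r : ℝ)) ν

/-- Jensen's gap `τ_i(ε) = E[exp (ε r)] - exp (ε μ_i)` of an arm with reward law `ν`. -/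
def jensenGap (ε : ℝ) (ν : Measure unitInterval) : ℝ :=
  (∫ r, Real.exp (ε * (r : ℝ)) ∂ν) - Real.exp (ε * mean ν)

/-! ### Bernoulli mechanisms -/

/-- Given the reward `r`, the output is a Bernoulli variable (with values `1` and `0`) of
parameter `p r`. -/
def bernoulliMechanism (p : unitInterval → unitInterval) (hp : Measurable p) :
    Kernel unitInterval ℝ where
  toFun r := bernoulliMeasure (1 : ℝ) 0 (p r)
  measurable' := by
    refine Measure.measurable_of_measurable_coe _ fun s hs => ?_
    classical
    simp only [bernoulliMeasure_apply _ hs]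
    have h1 : Measurable fun r => ((unitInterval.toNNReal (p r) : NNReal) : ENNReal) :=
      (unitInterval.toNNReal_continuous.measurable.comp hp).coe_nnreal_ennreal
    have h2 : Measurable fun r =>
        ((unitInterval.toNNReal (unitInterval.symm (p r)) : NNReal) : ENNReal) :=
      (unitInterval.toNNReal_continuous.measurable.comp
        (unitInterval.continuous_symm.measurable.comp hp)).coe_nnreal_ennreal
    split_ifs
    · exact measurable_const
    · exact h1
    · exact h2
    · exact measurable_const

instance (p : unitInterval → unitInterval) (hp : Measurable p) :
    IsMarkovKernel (bernoulliMechanism p hp) :=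
  ⟨fun r => inferInstanceAs (IsProbabilityMeasure (bernoulliMeasure (1 : ℝ) 0 (p r)))⟩

/-- The mean `μ_{i,ε} = E[p(r)]` of the privatized reward of an arm with reward law `ν`. -/
def privMean (p : unitInterval → unitInterval) (ν : Measure unitInterval) : ℝ :=
  ∫ r, (p r : ℝ) ∂ν

lemma quadratic_mem {ε b : ℝ} (hb : b ∈ Set.Icc 0 (2 * (Real.exp ε - 1))) (r : unitInterval) :
    ((Real.exp ε - 1 - b) * (r : ℝ) ^ 2 + b * r + 1) / (1 + Real.exp ε) ∈ Set.Icc (0 : ℝ) 1 := by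
  obtain ⟨hb0, hb1⟩ := hb
  have h0 := r.2.1
  have h1 := r.2.2
  have hm : 0 ≤ (r : ℝ) * (1 - r) := mul_nonneg h0 (by linarith)
  have hE := Real.exp_pos ε
  constructor
  · apply div_nonneg _ (by linarith)
    nlinarith [mul_nonneg hb0 hm, sq_nonneg (r : ℝ), mul_nonneg (sq_nonneg (r : ℝ)) hb0]
  · rw [div_le_one (by linarith)]
    nlinarith [mul_le_mul_of_nonneg_right hb1 hm,
      mul_nonneg (show 0 ≤ Real.exp ε - 1 by linarith) (sq_nonneg (1 - (r : ℝ)))]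

/-- The quadratic probability function
`p(r) = ((e^ε - 1 - b) r² + b r + 1) / (1 + e^ε)`, for `0 ≤ b ≤ 2 (e^ε - 1)`. -/
def quadraticProb (ε b : ℝ) (hb : b ∈ Set.Icc 0 (2 * (Real.exp ε - 1))) (r : unitInterval) :
    unitInterval :=
  ⟨((Real.exp ε - 1 - b) * (r : ℝ) ^ 2 + b * r + 1) / (1 + Real.exp ε), quadratic_mem hb r⟩

lemma measurable_quadraticProb (ε b : ℝ) (hb : b ∈ Set.Icc 0 (2 * (Real.exp ε - 1))) :
    Measurable (quadraticProb ε b hb) := by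
  unfold quadraticProb
  exact Measurable.subtype_mk (by fun_prop)

lemma exponential_mem {ε : ℝ} (hε : 0 < ε) (r : unitInterval) :
    Real.exp (ε * (r : ℝ)) / (Real.exp ε + 1) ∈ Set.Icc (0 : ℝ) 1 := by
  have hE := Real.exp_pos ε
  constructor
  · positivity
  · rw [div_le_one (by linarith)]
    have : Real.exp (ε * (r : ℝ)) ≤ Real.exp ε :=
      Real.exp_le_exp.2 (mul_le_of_le_one_right hε.le r.2.2)
    linarith

/-- The exponential probability function `p(r) = e^{ε r} / (e^ε + 1)`. -/
def exponentialProb (ε : ℝ) (hε : 0 < ε) (r : unitInterval) : unitInterval :=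
  ⟨Real.exp (ε * (r : ℝ)) / (Real.exp ε + 1), exponential_mem hε r⟩

lemma measurable_exponentialProb (ε : ℝ) (hε : 0 < ε) : Measurable (exponentialProb ε hε) := by
  unfold exponentialProb
  exact Measurable.subtype_mk (by fun_prop)

/-! ### The UCB algorithm on privatized rewards

Rounds are numbered `0, 1, 2, …`, so that exactly `t` rounds precede round `t`. An action process
is `I : ℕ → Ω → Fin N`, with `I t` the arm played in round `t`. `R i k` is the reward and `Y i k`
its privatized version on the `k`-th play of arm `i` (`k = 0, 1, 2, …`). -/

variable {N : ℕ} {Ω : Type*}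

/-- The number of plays of arm `i` before round `t`. -/
def pulls (I : ℕ → Ω → Fin N) (i : Fin N) (t : ℕ) (ω : Ω) : ℕ :=
  ((Finset.range t).filter fun s => I s ω = i).card

/-- The privatized reward observed in round `t`. -/
def observation (Y : Fin N → ℕ → Ω → ℝ) (I : ℕ → Ω → Fin N) (t : ℕ) (ω : Ω) : ℝ :=
  Y (I t ω) (pulls I (I t ω) t ω) ω

/-- The average of the privatized rewards observed on arm `i` before round `t`. -/
def empiricalMean (Y : Fin N → ℕ → Ω → ℝ) (I : ℕ → Ω → Fin N) (i : Fin N) (t : ℕ) (ω : Ω) : ℝ :=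
  (∑ s ∈ (Finset.range t).filter (fun s => I s ω = i), observation Y I s ω) / pulls I i t ω

/-- The upper confidence bound of arm `i` after the first `t` rounds. -/
def ucbIndex (Y : Fin N → ℕ → Ω → ℝ) (I : ℕ → Ω → Fin N) (i : Fin N) (t : ℕ) (ω : Ω) : ℝ :=
  empiricalMean Y I i t ω + Real.sqrt (2 * Real.log t / pulls I i t ω)

/-- A run of UCB on the outputs of the Bernoulli mechanism with probability function `p`, for
arms with reward laws `ν`. The pairs (reward, privatized reward) of all plays of all arms are
independent; each reward of arm `i` has law `ν i`, and its privatized version is drawn from the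
mechanism applied to it. As long as some arm has never been played, such an arm is played;
afterwards, an arm of maximal upper confidence bound is played (any tie-breaking is allowed). -/
structure IsUCBRun [MeasurableSpace Ω] (P : Measure Ω) (ν : Fin N → Measure unitInterval)
    (p : unitInterval → unitInterval) (hp : Measurable p)
    (R : Fin N → ℕ → Ω → unitInterval) (Y : Fin N → ℕ → Ω → ℝ) (I : ℕ → Ω → Fin N) : Prop where
  indep : iIndepFun (fun (x : Fin N × ℕ) ω => (R x.1 x.2 ω, Y x.1 x.2 ω)) P
  law : ∀ i k, HasLaw (fun ω => (R i k ω, Y i k ω)) ((ν i).compProd (bernoulliMechanism p hp)) P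
  measurable_action : ∀ t, Measurable (I t)
  explore : ∀ t ω, (∃ i, pulls I i t ω = 0) → pulls I (I t ω) t ω = 0
  exploit : ∀ t ω, (∀ i, 0 < pulls I i t ω) →
    ∀ i, ucbIndex Y I i t ω ≤ ucbIndex Y I (I t ω) t ω

/-! ### Gaps and regret -/

/-- The gap `Δ_i = μ_{i₁} - μ_i` of arm `i` to the arm `i₁`. -/
def gap (ν : Fin N → Measure unitInterval) (i₁ i : Fin N) : ℝ := mean (ν i₁) - mean (ν i)

/-- The privatized gap `Δ_{i,ε} = max_j μ_{j,ε} - μ_{i,ε}` of arm `i`. -/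
def privGap (p : unitInterval → unitInterval) (ν : Fin N → Measure unitInterval) (i : Fin N) : ℝ :=
  (⨆ j, privMean p (ν j)) - privMean p (ν i)

/-- The cumulative regret `R(T) = E[∑_{t ≤ T} (μ_{i₁} - μ_{I_t})]` over the first `T` rounds,
where `i₁` is an optimal arm. -/
def regret [MeasurableSpace Ω] (P : Measure Ω) (ν : Fin N → Measure unitInterval) (i₁ : Fin N)
    (I : ℕ → Ω → Fin N) (T : ℕ) : ℝ :=
  ∫ ω, ∑ t ∈ Finset.range T, gap ν i₁ (I t ω) ∂P

/-- `∑_{i ≠ i₁} (8 log T / δ_i² + 1 + π² / 3) Δ_i`. -/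
def ucbBound (ν : Fin N → Measure unitInterval) (i₁ : Fin N) (δ : Fin N → ℝ) (T : ℕ) : ℝ :=
  ∑ i ∈ Finset.univ.erase i₁, (8 * Real.log T / δ i ^ 2 + 1 + Real.pi ^ 2 / 3) * gap ν i₁ i

/-- The value of `μ_{1,ε} - μ_{i,ε}` for the quadratic probability function, in terms of means
and variances. -/
def quadraticGap (ε b : ℝ) (ν : Fin N → Measure unitInterval) (i₁ i : Fin N) : ℝ :=
  (((Real.exp ε - 1 - b) * (mean (ν i₁) + mean (ν i)) + b) * (mean (ν i₁) - mean (ν i))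
    + (Real.exp ε - 1 - b) * (rewardVar (ν i₁) - rewardVar (ν i))) / (Real.exp ε + 1)

/-- The value of `μ_{1,ε} - μ_{i,ε}` for the exponential probability function, in terms of means
and Jensen's gaps. -/
def exponentialGap (ε : ℝ) (ν : Fin N → Measure unitInterval) (i₁ i : Fin N) : ℝ :=
  (Real.exp (ε * mean (ν i)) * (Real.exp (ε * gap ν i₁ i) - 1)
    + jensenGap ε (ν i₁) - jensenGap ε (ν i)) / (Real.exp ε + 1)

end PrivateBandit

end

open MeasureTheory ProbabilityTheory

noncomputable section

namespace PrivateBandit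

/-! ### Privatized means -/

/-! The outputs on each arm are i.i.d. in `[0, 1]` with mean `privMean`, so the classical UCB1
analysis applies to them; the original rewards enter only through the gaps that weight the play
counts in the regret (`regret_eq_sum`). Once arm `i` has more than `8 log T / δ²` plays, where `δ`
is its privatized deficit to some arm `j`, choosing it again forces a confidence bound of `i` or `j`
to fail (`exists_confidence_failure`). By Hoeffding and a union bound over possible play counts,
round `t` contributes at most `2 / t²`, which sums to `π² / 3` (`integral_pulls_le`). The comparison
arm `j` is arbitrary: the best privatized arm gives (a), and `i₁` itself gives (b) and (c), even
when `i₁` is not optimal after privatization. The gap formulas follow from `E[r²] = σ² + μ²` and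
from the definition of Jensen's gap. -/

lemma integrable_of_continuous {ν : Measure unitInterval} [IsProbabilityMeasure ν]
    {f : unitInterval → ℝ} (hf : Continuous f) : Integrable f ν :=
  (BoundedContinuousFunction.mkOfCompact ⟨f, hf⟩).integrable ν

lemma privMean_quadraticProb {ε b : ℝ} (hb : b ∈ Set.Icc 0 (2 * (Real.exp ε - 1)))
    (ν : Measure unitInterval) [IsProbabilityMeasure ν] :
    privMean (quadraticProb ε b hb) ν
      = ((Real.exp ε - 1 - b) * (rewardVar ν + mean ν ^ 2) + b * mean ν + 1)
        / (1 + Real.exp ε) := by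
  have hvar : rewardVar ν = (∫ r : unitInterval, (r : ℝ) ^ 2 ∂ν) - mean ν ^ 2 := by
    have hL : MemLp (fun r : unitInterval => (r : ℝ)) 2 ν :=
      MemLp.of_bound (by fun_prop) 1
        (ae_of_all _ fun r => by
          rw [Real.norm_eq_abs, abs_of_nonneg r.2.1]; exact r.2.2)
    exact variance_eq_sub hL
  have h1 : Integrable (fun r : unitInterval => (Real.exp ε - 1 - b) * (r : ℝ) ^ 2) ν :=
    integrable_of_continuous (by fun_prop)
  have h2 : Integrable (fun r : unitInterval => b * (r : ℝ)) ν :=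
    integrable_of_continuous (by fun_prop)
  have h12 : Integrable
      (fun r : unitInterval => (Real.exp ε - 1 - b) * (r : ℝ) ^ 2 + b * (r : ℝ)) ν := h1.add h2
  rw [hvar, sub_add_cancel]
  simp only [privMean, quadraticProb]
  rw [integral_div, integral_add h12 (integrable_const _), integral_add h1 h2,
    integral_const_mul, integral_const_mul]
  simp [mean]

lemma privMean_exponentialProb {ε : ℝ} (hε : 0 < ε) (ν : Measure unitInterval) :
    privMean (exponentialProb ε hε) ν
      = (Real.exp (ε * mean ν) + jensenGap ε ν) / (Real.exp ε + 1) := by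
  simp only [privMean, exponentialProb, jensenGap]
  rw [integral_div]
  ring

lemma privMean_sub_quadraticProb {N : ℕ} {ε b : ℝ}
    (hb : b ∈ Set.Icc 0 (2 * (Real.exp ε - 1)))
    (ν : Fin N → Measure unitInterval) [∀ i, IsProbabilityMeasure (ν i)] (i₁ i : Fin N) :
    privMean (quadraticProb ε b hb) (ν i₁) - privMean (quadraticProb ε b hb) (ν i)
      = quadraticGap ε b ν i₁ i := by
  rw [privMean_quadraticProb, privMean_quadraticProb, quadraticGap, ← sub_div,
    add_comm 1 (Real.exp ε)]
  ring

lemma privMean_sub_exponentialProb {N : ℕ} {ε : ℝ} (hε : 0 < ε)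
    (ν : Fin N → Measure unitInterval) (i₁ i : Fin N) :
    privMean (exponentialProb ε hε) (ν i₁) - privMean (exponentialProb ε hε) (ν i)
      = exponentialGap ε ν i₁ i := by
  have h : Real.exp (ε * mean (ν i₁)) = Real.exp (ε * mean (ν i)) * Real.exp (ε * gap ν i₁ i) := by
    rw [← Real.exp_add, gap]
    ring_nf
  rw [privMean_exponentialProb, privMean_exponentialProb, exponentialGap, ← sub_div, h]
  ring

/-! ### Hoeffding's inequality for averages of `[0, 1]`-valued variables -/

variable {N : ℕ} {Ω : Type*} [MeasurableSpace Ω] {P : Measure Ω} [IsProbabilityMeasure P]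

lemma measureReal_sum_sub_ge_le {X : ℕ → Ω → ℝ} {m : ℝ} (hind : iIndepFun X P)
    (hX : ∀ k, AEMeasurable (X k) P) (hmem : ∀ k, ∀ᵐ ω ∂P, X k ω ∈ Set.Icc (0 : ℝ) 1)
    (hmean : ∀ k, P[X k] = m) (n : ℕ) {c : ℝ} (hc : 0 ≤ c) :
    P.real {ω | n * (m + c) ≤ ∑ k ∈ Finset.range n, X k ω} ≤ Real.exp (-(2 * n * c ^ 2)) := by
  have hsub : ∀ k < n, HasSubgaussianMGF (fun ω => X k ω - m) ((‖(1 : ℝ) - 0‖₊ / 2) ^ 2) P :=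
    fun k _ => hmean k ▸ hasSubgaussianMGF_of_mem_Icc (hX k) (hmem k)
  have hind' : iIndepFun (fun k ω => X k ω - m) P :=
    hind.comp (fun _ x => x - m) (fun _ => by fun_prop)
  have h := HasSubgaussianMGF.measure_sum_range_ge_le_of_iIndepFun hind' hsub
    (ε := n * c) (by positivity)
  convert h using 2
  · ext ω
    simp only [Set.mem_ofPred_eq, Finset.sum_sub_distrib, Finset.sum_const, Finset.card_range,
      nsmul_eq_mul]
    constructor <;> intro h <;> linarith
  -- The sub-Gaussian parameter is 1/4 per variable, so the exponent is `-(nc)² / (2 · n/4)`; for `n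
  -- = 0` this is `0 / 0 = 0`.
  · rcases Nat.eq_zero_or_pos n with rfl | hn
    · simp
    · have : (n : ℝ) ≠ 0 := by positivity
      simp
      field_simp

/-- Apply the upper tail to `1 - X k`. -/
lemma measureReal_sum_sub_le_le {X : ℕ → Ω → ℝ} {m : ℝ} (hind : iIndepFun X P)
    (hX : ∀ k, AEMeasurable (X k) P) (hmem : ∀ k, ∀ᵐ ω ∂P, X k ω ∈ Set.Icc (0 : ℝ) 1)
    (hmean : ∀ k, P[X k] = m) (n : ℕ) {c : ℝ} (hc : 0 ≤ c) :
    P.real {ω | ∑ k ∈ Finset.range n, X k ω ≤ n * (m - c)} ≤ Real.exp (-(2 * n * c ^ 2)) := by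
  have hint : ∀ k, Integrable (X k) P := fun k => Integrable.of_mem_Icc 0 1 (hX k) (hmem k)
  have h := measureReal_sum_sub_ge_le (P := P) (X := fun k ω => 1 - X k ω) (m := 1 - m)
    (hind.comp (fun _ x => 1 - x) (fun _ => by fun_prop)) (fun k => (hX k).const_sub 1)
    (fun k => by
      filter_upwards [hmem k] with ω hω
      exact ⟨by linarith [hω.2], by linarith [hω.1]⟩)
    (fun k => by
      rw [integral_sub (integrable_const _) (hint k), hmean k]
      simp) n hc
  convert h using 3
  ext ω
  simp only [Finset.sum_sub_distrib, Finset.sum_const, Finset.card_range, nsmul_eq_mul]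
  constructor <;> intro h <;> linarith

/-! ### Paths of the UCB algorithm -/

/-- The width `√(2 log t / s)` of the confidence interval after `t` rounds, for an arm with
`s` plays. -/
def confWidth (t s : ℕ) : ℝ := Real.sqrt (2 * Real.log t / s)

omit [MeasurableSpace Ω] in
lemma pulls_succ (I : ℕ → Ω → Fin N) (i : Fin N) (t : ℕ) (ω : Ω) :
    pulls I i (t + 1) ω = pulls I i t ω + if I t ω = i then 1 else 0 := by
  unfold pulls
  rw [Finset.range_add_one, Finset.filter_insert]
  split_ifs <;> simp

omit [MeasurableSpace Ω] in
lemma pulls_le (I : ℕ → Ω → Fin N) (i : Fin N) (t : ℕ) (ω : Ω) : pulls I i t ω ≤ t :=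
  (Finset.card_filter_le _ _).trans (Finset.card_range t).le

omit [MeasurableSpace Ω] in
-- Adaptive sampling only selects how many terms of a fixed i.i.d. sequence are summed, so a union
-- bound over that number suffices.
lemma sum_observation_eq (Y : Fin N → ℕ → Ω → ℝ) (I : ℕ → Ω → Fin N) (i : Fin N) (t : ℕ) (ω : Ω) :
    ∑ s ∈ (Finset.range t).filter (fun s => I s ω = i), observation Y I s ω
      = ∑ k ∈ Finset.range (pulls I i t ω), Y i k ω := by
  induction t with
  | zero => simp [pulls]
  | succ t ih =>
    rw [pulls_succ, Finset.range_add_one, Finset.filter_insert]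
    split_ifs with h
    · rw [Finset.sum_insert (by simp), ih, Finset.sum_range_succ, add_comm, observation, h]
    · simpa using ih

omit [MeasurableSpace Ω] in
-- All plays of `i` after its first `l` happen when it already has at least `l` plays.
lemma pulls_le_add_card (I : ℕ → Ω → Fin N) (i : Fin N) (l T : ℕ) (ω : Ω) :
    pulls I i T ω
      ≤ l + ((Finset.range T).filter fun t => I t ω = i ∧ l ≤ pulls I i t ω).card := by
  induction T with
  | zero => simp [pulls]
  | succ t ih =>
    rw [pulls_succ, Finset.range_add_one, Finset.filter_insert]
    by_cases h : I t ω = i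
    · by_cases hl : l ≤ pulls I i t ω
      · simp only [h, hl, and_self, if_true]
        rw [Finset.card_insert_of_notMem (by simp)]
        omega
      · simp only [h, hl, and_false, if_true, if_false]
        omega
    · simpa [h] using ih

omit [MeasurableSpace Ω] in
/-- If UCB plays arm `i` although it has been played sufficiently often, then the confidence
interval of arm `i` or the one of the better arm `j` fails. -/
lemma exists_confidence_failure (Y : Fin N → ℕ → Ω → ℝ) (I : ℕ → Ω → Fin N) (m : Fin N → ℝ)
    {i j : Fin N} {t : ℕ} {ω : Ω} (hpos : ∀ i, 0 < pulls I i t ω)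
    (hle : ucbIndex Y I j t ω ≤ ucbIndex Y I i t ω) (hm : m i < m j)
    (hlog : 8 * Real.log t < pulls I i t ω * (m j - m i) ^ 2) :
    ∃ s ∈ Finset.Icc 1 t,
      s * (m i + confWidth t s) ≤ ∑ k ∈ Finset.range s, Y i k ω ∨
      ∑ k ∈ Finset.range s, Y j k ω ≤ s * (m j - confWidth t s) := by
  by_contra! hcon
  have hi := (hcon _ (Finset.mem_Icc.2 ⟨hpos i, pulls_le I i t ω⟩)).1
  have hj := (hcon _ (Finset.mem_Icc.2 ⟨hpos j, pulls_le I j t ω⟩)).2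
  have hpi : (0 : ℝ) < pulls I i t ω := by exact_mod_cast hpos i
  have hpj : (0 : ℝ) < pulls I j t ω := by exact_mod_cast hpos j
  simp only [ucbIndex, empiricalMean, sum_observation_eq] at hle
  rw [← div_lt_iff₀' hpi] at hi
  rw [← lt_div_iff₀' hpj] at hj
  -- Squared, this is `hlog`. If no interval fails, the index of `i` is below `m i` plus two widths,
  -- hence below `m j`, which is below the index of `j`.
  have hw : confWidth t (pulls I i t ω) ≤ (m j - m i) / 2 := by
    apply Real.sqrt_le_iff.2 ⟨by linarith, ?_⟩
    rw [div_le_iff₀ hpi]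
    nlinarith
  unfold confWidth at hi hj hw
  linarith

/-! ### The expected number of plays -/

lemma exp_confWidth {t s : ℕ} (ht : 1 ≤ t) (hs : 1 ≤ s) :
    Real.exp (-(2 * s * confWidth t s ^ 2)) = 1 / (t : ℝ) ^ 4 := by
  have hs' : (0 : ℝ) < s := by exact_mod_cast hs
  have ht' : (0 : ℝ) < t := by exact_mod_cast ht
  have hl : 0 ≤ Real.log t := Real.log_natCast_nonneg t
  rw [confWidth, Real.sq_sqrt (by positivity), one_div, Real.exp_neg]
  congr 1
  rw [show 2 * (s : ℝ) * (2 * Real.log t / s) = (4 : ℕ) * Real.log t by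
    field_simp; ring, Real.exp_nat_mul, Real.exp_log ht']

lemma measurable_pulls {I : ℕ → Ω → Fin N} (hI : ∀ t, Measurable (I t)) (i : Fin N) (t : ℕ) :
    Measurable (pulls I i t) := by
  induction t with
  | zero => exact measurable_const
  | succ t ih =>
    rw [show pulls I i (t + 1) = fun ω => pulls I i t ω + if I t ω = i then 1 else 0 from
      funext fun ω => pulls_succ I i t ω]
    exact ih.add (Measurable.ite (hI t (measurableSet_singleton i)) measurable_const
      measurable_const)

lemma integrable_pulls {I : ℕ → Ω → Fin N} (hI : ∀ t, Measurable (I t)) (i : Fin N) (t : ℕ) :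
    Integrable (fun ω => (pulls I i t ω : ℝ)) P := by
  refine Integrable.of_bound
    (measurable_from_top.comp (measurable_pulls hI i t)).aestronglyMeasurable t
    (ae_of_all _ fun ω => ?_)
  simpa using pulls_le I i t ω

lemma sum_two_div_sq_le (T : ℕ) :
    ∑ t ∈ Finset.range T, 2 / (t : ℝ) ^ 2 ≤ Real.pi ^ 2 / 3 := by
  have h := sum_le_hasSum (Finset.range T) (fun t _ => by positivity) hasSum_zeta_two
  calc ∑ t ∈ Finset.range T, 2 / (t : ℝ) ^ 2
      = 2 * ∑ t ∈ Finset.range T, 1 / (t : ℝ) ^ 2 := by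
        rw [Finset.mul_sum]; exact Finset.sum_congr rfl fun _ _ => by ring
    _ ≤ Real.pi ^ 2 / 3 := by linarith

namespace IsUCBRun

variable {ν : Fin N → Measure unitInterval} [∀ i, IsProbabilityMeasure (ν i)]
  {p : unitInterval → unitInterval} {hp : Measurable p}
  {R : Fin N → ℕ → Ω → unitInterval} {Y : Fin N → ℕ → Ω → ℝ} {I : ℕ → Ω → Fin N}

omit [IsProbabilityMeasure P] [∀ i, IsProbabilityMeasure (ν i)] in
lemma aemeasurable_output (h : IsUCBRun P ν p hp R Y I) (i : Fin N) (k : ℕ) :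
    AEMeasurable (Y i k) P :=
  measurable_snd.comp_aemeasurable (h.law i k).aemeasurable

omit [IsProbabilityMeasure P] in
lemma output_mem_Icc (h : IsUCBRun P ν p hp R Y I) (i : Fin N) (k : ℕ) :
    ∀ᵐ ω ∂P, Y i k ω ∈ Set.Icc (0 : ℝ) 1 := by
  have hs : MeasurableSet {x : unitInterval × ℝ | x.2 ∈ Set.Icc (0 : ℝ) 1} :=
    measurable_snd measurableSet_Icc
  refine ((h.law i k).ae_iff (p := fun x => x.2 ∈ Set.Icc (0 : ℝ) 1)
    (measurableSet_setOfPred.1 hs)).2 ?_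
  rw [Measure.ae_compProd_iff hs]
  refine ae_of_all _ fun r => ?_
  change ∀ᵐ y ∂(bernoulliMeasure (1 : ℝ) 0 (p r)), y ∈ Set.Icc (0 : ℝ) 1
  rw [ae_iff]
  exact bernoulliMeasure_apply_of_notMem_of_notMem (p r) measurableSet_Icc.compl
    (by simp) (by simp)

lemma integral_output (h : IsUCBRun P ν p hp R Y I) (i : Fin N) (k : ℕ) :
    P[Y i k] = privMean p (ν i) := by
  have hint : Integrable (Y i k) P :=
    Integrable.of_mem_Icc 0 1 (h.aemeasurable_output i k) (h.output_mem_Icc i k)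
  have hint' : Integrable (fun x : unitInterval × ℝ => x.2)
      ((ν i).compProd (bernoulliMechanism p hp)) := by
    rw [← (h.law i k).map_eq, integrable_map_measure (by fun_prop) (h.law i k).aemeasurable]
    exact hint
  have hc := (h.law i k).integral_comp (f := fun x => x.2) (by fun_prop)
  rw [Measure.integral_compProd hint'] at hc
  refine hc.trans (integral_congr_ae (ae_of_all _ fun r => ?_))
  change ∫ y, y ∂(bernoulliMeasure (1 : ℝ) 0 (p r)) = _
  simp [integral_bernoulliMeasure]

omit [IsProbabilityMeasure P] [∀ i, IsProbabilityMeasure (ν i)] in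
lemma iIndepFun_output (h : IsUCBRun P ν p hp R Y I) (i : Fin N) :
    iIndepFun (fun k => Y i k) P :=
  (h.indep.precomp (Prod.mk_right_injective i)).comp (fun _ x => x.2) (fun _ => measurable_snd)

lemma measureReal_overplayed_le (h : IsUCBRun P ν p hp R Y I) {i j : Fin N}
    (hij : privMean p (ν i) < privMean p (ν j)) {l t : ℕ} (hl : 1 ≤ l)
    (hlog : 8 * Real.log t < l * (privMean p (ν j) - privMean p (ν i)) ^ 2) :
    P.real {ω | I t ω = i ∧ l ≤ pulls I i t ω} ≤ 2 / (t : ℝ) ^ 2 := by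
  rcases Nat.eq_zero_or_pos t with rfl | ht
  -- The bound reads `2 / 0 = 0` here, so the event has to be null; `1 ≤ l` makes it empty.
  · have : {ω | I 0 ω = i ∧ l ≤ pulls I i 0 ω} = ∅ := by
      ext ω
      simp [pulls]
      omega
    simp [this]
  let U : ℕ → Set Ω := fun s =>
    {ω | s * (privMean p (ν i) + confWidth t s) ≤ ∑ k ∈ Finset.range s, Y i k ω}
  let L : ℕ → Set Ω := fun s =>
    {ω | ∑ k ∈ Finset.range s, Y j k ω ≤ s * (privMean p (ν j) - confWidth t s)}
  have hsub : {ω | I t ω = i ∧ l ≤ pulls I i t ω} ⊆ ⋃ s ∈ Finset.Icc 1 t, U s ∪ L s := by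
    rintro ω ⟨hi, hlp⟩
    -- Were some arm unplayed, the exploration rule would not replay `i`, which has at least `l ≥ 1`
    -- plays.
    have hpos : ∀ j, 0 < pulls I j t ω := by
      by_contra! hcon
      obtain ⟨j, hj⟩ := hcon
      have := h.explore t ω ⟨j, by omega⟩
      rw [hi] at this
      omega
    have hlp' : (l : ℝ) ≤ pulls I i t ω := by exact_mod_cast hlp
    obtain ⟨s, hs, hsω⟩ := exists_confidence_failure Y I (fun j => privMean p (ν j)) hpos
      (hi ▸ h.exploit t ω hpos j) hij
      (hlog.trans_le (mul_le_mul_of_nonneg_right hlp' (sq_nonneg _)))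
    exact Set.mem_biUnion hs hsω
  have hbound : ∀ s ∈ Finset.Icc 1 t, P.real (U s ∪ L s) ≤ 2 / (t : ℝ) ^ 4 := by
    intro s hs
    have hw : 0 ≤ confWidth t s := Real.sqrt_nonneg _
    have h1 := measureReal_sum_sub_ge_le (h.iIndepFun_output i) (h.aemeasurable_output i)
      (h.output_mem_Icc i) (h.integral_output i) s hw
    have h2 := measureReal_sum_sub_le_le (h.iIndepFun_output j) (h.aemeasurable_output j)
      (h.output_mem_Icc j) (h.integral_output j) s hw
    rw [exp_confWidth ht (Finset.mem_Icc.1 hs).1] at h1 h2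
    calc P.real (U s ∪ L s) ≤ P.real (U s) + P.real (L s) := measureReal_union_le _ _
      _ ≤ 1 / (t : ℝ) ^ 4 + 1 / (t : ℝ) ^ 4 := add_le_add h1 h2
      _ = 2 / (t : ℝ) ^ 4 := by ring
  have ht1 : (1 : ℝ) ≤ t := by exact_mod_cast ht
  calc P.real {ω | I t ω = i ∧ l ≤ pulls I i t ω}
      ≤ P.real (⋃ s ∈ Finset.Icc 1 t, U s ∪ L s) := measureReal_mono hsub (measure_ne_top _ _)
    _ ≤ ∑ s ∈ Finset.Icc 1 t, P.real (U s ∪ L s) := measureReal_biUnion_finset_le _ _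
    _ ≤ ∑ s ∈ Finset.Icc 1 t, 2 / (t : ℝ) ^ 4 := Finset.sum_le_sum hbound
    _ = 2 / (t : ℝ) ^ 3 := by
      simp only [Finset.sum_const, Nat.card_Icc, Nat.add_sub_cancel, nsmul_eq_mul]
      field_simp
    -- A factor `t` is given away so that the series sums to `π² / 3`.
    _ ≤ 2 / (t : ℝ) ^ 2 := by
      gcongr
      norm_num

lemma integral_pulls_le (h : IsUCBRun P ν p hp R Y I) {i j : Fin N}
    (hij : privMean p (ν i) < privMean p (ν j)) (T : ℕ) :
    ∫ ω, (pulls I i T ω : ℝ) ∂P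
      ≤ 8 * Real.log T / (privMean p (ν j) - privMean p (ν i)) ^ 2 + 1 + Real.pi ^ 2 / 3 := by
  set δ := privMean p (ν j) - privMean p (ν i)
  have hδ0 : 0 < δ := sub_pos.2 hij
  have hT : 0 ≤ 8 * Real.log T / δ ^ 2 := by
    have := Real.log_natCast_nonneg T
    positivity
  -- The least integer strictly above the threshold; rounding up costs the `+ 1` of the bound.
  set l : ℕ := ⌊8 * Real.log T / δ ^ 2⌋₊ + 1 with hl
  have hlt : 8 * Real.log T / δ ^ 2 < l := by
    rw [hl]; push_cast; exact Nat.lt_floor_add_one _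
  have hle : (l : ℝ) ≤ 8 * Real.log T / δ ^ 2 + 1 := by
    rw [hl]; push_cast; linarith [Nat.floor_le hT]
  rw [div_lt_iff₀ (by positivity)] at hlt
  set A : ℕ → Set Ω := fun t => {ω | I t ω = i ∧ l ≤ pulls I i t ω} with hA
  have hAm : ∀ t, MeasurableSet (A t) := fun t =>
    (h.measurable_action t (measurableSet_singleton i)).inter
      (measurable_pulls h.measurable_action i t measurableSet_Ici)
  have hAi : ∀ t, Integrable ((A t).indicator fun _ => (1 : ℝ)) P := fun t =>
    (integrable_const _).indicator (hAm t)
  have hpath : ∀ ω, (pulls I i T ω : ℝ)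
      ≤ l + ∑ t ∈ Finset.range T, (A t).indicator (fun _ => (1 : ℝ)) ω := by
    intro ω
    have := pulls_le_add_card I i l T ω
    rw [Finset.card_filter] at this
    have h' : (pulls I i T ω : ℝ)
        ≤ l + ∑ t ∈ Finset.range T, if I t ω = i ∧ l ≤ pulls I i t ω then (1 : ℝ) else 0 := by
      exact_mod_cast this
    simpa [hA, Set.indicator_apply] using h'
  have hsum : Integrable
      (fun ω => ∑ t ∈ Finset.range T, (A t).indicator (fun _ => (1 : ℝ)) ω) P :=
    integrable_finsetSum _ fun t _ => hAi t
  calc ∫ ω, (pulls I i T ω : ℝ) ∂P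
      ≤ ∫ ω, (l + ∑ t ∈ Finset.range T, (A t).indicator (fun _ => (1 : ℝ)) ω) ∂P :=
        integral_mono (integrable_pulls h.measurable_action i T)
          ((integrable_const _).add hsum) hpath
    _ = l + ∑ t ∈ Finset.range T, P.real (A t) := by
        rw [integral_add (integrable_const _) hsum, integral_finsetSum _ fun t _ => hAi t]
        simp [integral_indicator_const, hAm]
    _ ≤ l + ∑ t ∈ Finset.range T, 2 / (t : ℝ) ^ 2 := by
        gcongr with t ht
        refine h.measureReal_overplayed_le hij (Nat.le_add_left _ _) (lt_of_le_of_lt ?_ hlt)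
        rcases Nat.eq_zero_or_pos t with rfl | ht0
        · simpa using Real.log_natCast_nonneg T
        · have : (t : ℝ) ≤ T := by exact_mod_cast (Finset.mem_range.1 ht).le
          have := Real.log_le_log (by exact_mod_cast ht0) this
          linarith
    _ ≤ 8 * Real.log T / δ ^ 2 + 1 + Real.pi ^ 2 / 3 := by
        linarith [sum_two_div_sq_le T]

omit [∀ i, IsProbabilityMeasure (ν i)] in
lemma regret_eq_sum (h : IsUCBRun P ν p hp R Y I) (i₁ : Fin N) (T : ℕ) :
    regret P ν i₁ I T = ∑ i, (∫ ω, (pulls I i T ω : ℝ) ∂P) * gap ν i₁ i := by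
  have hpath : ∀ ω, ∑ t ∈ Finset.range T, gap ν i₁ (I t ω)
      = ∑ i, (pulls I i T ω : ℝ) * gap ν i₁ i := by
    intro ω
    rw [← Finset.sum_fiberwise (Finset.range T) (fun t => I t ω)]
    refine Finset.sum_congr rfl fun i _ => ?_
    rw [Finset.sum_congr rfl fun t ht => by rw [(Finset.mem_filter.1 ht).2], Finset.sum_const,
      nsmul_eq_mul, pulls]
  simp only [regret, hpath]
  rw [integral_finsetSum _ fun i _ => (integrable_pulls h.measurable_action i T).mul_const _]
  simp only [integral_mul_const]

/-- The regret bound, where the number of plays of each suboptimal arm is controlled by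
comparison with some arm of larger privatized mean. -/
lemma regret_le (h : IsUCBRun P ν p hp R Y I) {i₁ : Fin N}
    (hopt : ∀ i, mean (ν i) ≤ mean (ν i₁)) {δ : Fin N → ℝ}
    (hδ : ∀ i, ∃ j, δ i = privMean p (ν j) - privMean p (ν i))
    (hpos : ∀ i, 0 < gap ν i₁ i → 0 < δ i) (T : ℕ) :
    regret P ν i₁ I T ≤ ucbBound ν i₁ δ T := by
  have hself : gap ν i₁ i₁ = 0 := sub_self _
  rw [h.regret_eq_sum, ucbBound, ← Finset.sum_erase Finset.univ (a := i₁) (by simp [hself])]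
  refine Finset.sum_le_sum fun i _ => ?_
  have hgap : 0 ≤ gap ν i₁ i := sub_nonneg.2 (hopt i)
  -- Nothing is known about the sign of `δ i` when the gap vanishes, but then both terms are zero.
  rcases hgap.eq_or_lt with hg | hg
  · rw [← hg, mul_zero, mul_zero]
  · obtain ⟨j, hj⟩ := hδ i
    have hlt : privMean p (ν i) < privMean p (ν j) := sub_pos.1 (hj ▸ hpos i hg)
    rw [hj]
    exact mul_le_mul_of_nonneg_right (h.integral_pulls_le hlt T) hg.le

end IsUCBRun

lemma exists_privGap_eq (p : unitInterval → unitInterval) (ν : Fin N → Measure unitInterval)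
    (i : Fin N) : ∃ j, privGap p ν i = privMean p (ν j) - privMean p (ν i) := by
  have : Nonempty (Fin N) := ⟨i⟩
  obtain ⟨j, hj⟩ := exists_eq_ciSup_of_finite (f := fun j => privMean p (ν j))
  exact ⟨j, by rw [privGap, ← hj]⟩

end PrivateBandit

end

open PrivateBandit in
theorem mainTheorem5 {N : ℕ} (ν : Fin N → Measure unitInterval) [∀ i, IsProbabilityMeasure (ν i)]
    (i₁ : Fin N) (hopt : ∀ i, mean (ν i) ≤ mean (ν i₁))
    {Ω : Type*} [MeasurableSpace Ω] (P : Measure Ω) [IsProbabilityMeasure P]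
    (R : Fin N → ℕ → Ω → unitInterval) (Y : Fin N → ℕ → Ω → ℝ) (I : ℕ → Ω → Fin N) :
    -- an arbitrary probability function
    (∀ (p : unitInterval → unitInterval) (hp : Measurable p), IsUCBRun P ν p hp R Y I →
      (∀ i, 0 < gap ν i₁ i → 0 < privGap p ν i) →
      ∀ T : ℕ, regret P ν i₁ I T ≤ ucbBound ν i₁ (privGap p ν) T) ∧
    -- the quadratic probability function
    (∀ (ε b : ℝ), 0 < ε → ∀ hb : b ∈ Set.Icc 0 (2 * (Real.exp ε - 1)),
      (∀ i, privMean (quadraticProb ε b hb) (ν i₁) - privMean (quadraticProb ε b hb) (ν i)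
        = quadraticGap ε b ν i₁ i) ∧
      (IsUCBRun P ν (quadraticProb ε b hb) (measurable_quadraticProb ε b hb) R Y I →
        (∀ i, 0 < gap ν i₁ i → 0 < quadraticGap ε b ν i₁ i) →
        ∀ T : ℕ, regret P ν i₁ I T ≤ ucbBound ν i₁ (quadraticGap ε b ν i₁) T)) ∧
    -- the exponential probability function
    (∀ (ε : ℝ) (hε : 0 < ε),
      (∀ i, privMean (exponentialProb ε hε) (ν i₁) - privMean (exponentialProb ε hε) (ν i)
        = exponentialGap ε ν i₁ i) ∧
      (IsUCBRun P ν (exponentialProb ε hε) (measurable_exponentialProb ε hε) R Y I →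
        (∀ i, 0 < gap ν i₁ i → 0 < exponentialGap ε ν i₁ i) →
        ∀ T : ℕ, regret P ν i₁ I T ≤ ucbBound ν i₁ (exponentialGap ε ν i₁) T)) := by
  refine ⟨fun p hp h hpos T => h.regret_le hopt (exists_privGap_eq p ν) hpos T,
    fun ε b _ hb => ⟨privMean_sub_quadraticProb hb ν i₁, fun h hpos T => ?_⟩,
    fun ε hε => ⟨privMean_sub_exponentialProb hε ν i₁, fun h hpos T => ?_⟩⟩
  · exact h.regret_le hopt (fun i => ⟨i₁, (privMean_sub_quadraticProb hb ν i₁ i).symm⟩) hpos T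
  · exact h.regret_le hopt (fun i => ⟨i₁, (privMean_sub_exponentialProb hε ν i₁ i).symm⟩) hpos T
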